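/- **Theorem.** Every $K_5$-minor-free graph is $5$-choosable. That is, let $G$ be a finite simple undirected graph having no $K_5$ minor, i.e. such that there do not exist five pairwise disjoint nonempty vertex sets $B_1,\dots,B_5\subseteq V(G)$, each inducing a connected subgraph of $G$, with an edge of $G$ between $B_i$ and $B_j$ for all $i\ne j$. Then for every function $L$ assigning to each vertex $v$ of $G$ a set $L(v)$ of colours with $|L(v)|\ge 5$, there is a colouring $c$ of the vertices of $G$ with $c(v)\in L(v)$ for every vertex $v$ and $c(v)\ne c(w)$ for every edge $vw$ of $G$. -/

import Mathlib

universe u v w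

namespace SimpleGraph

/-- `H` is a minor of `G`: there are pairwise disjoint branch sets in `G`, one for each vertex of
`H`, each inducing a connected (in particular nonempty) subgraph of `G`, such that for every edge
of `H` some edge of `G` joins the two corresponding branch sets. -/
def IsMinor {W : Type v} {V : Type u} (H : SimpleGraph W) (G : SimpleGraph V) : Prop :=
  ∃ B : W → Set V,
    (∀ i, (G.induce (B i)).Connected) ∧
    (∀ i j, i ≠ j → Disjoint (B i) (B j)) ∧
    (∀ i j, H.Adj i j → ∃ x ∈ B i, ∃ y ∈ B j, G.Adj x y)

/-- `G` is `L`-colourable: it has a proper colouring in which every vertex `x` receives a colour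
from its list `L x`. -/
def IsListColorable {V : Type u} {C : Type w} (G : SimpleGraph V) (L : V → Set C) : Prop :=
  ∃ c : G.Coloring C, ∀ x, c x ∈ L x

/-- `G` is `k`-choosable: it is `L`-colourable for every assignment `L` of sets of at least `k`
colours (possibly infinite) to its vertices. -/
def IsChoosable {V : Type u} (G : SimpleGraph V) (k : ℕ) : Prop :=
  ∀ (C : Type w) (L : V → Set C), (∀ x, (k : ℕ∞) ≤ (L x).encard) → G.IsListColorable L

end SimpleGraph

namespace SimpleGraph

/-! This is Thomassen's list-colouring induction for planar graphs, carried out with minors alone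
and without the structure theory of `K₅`-minor-free graphs. The outer face is replaced by a set `X ⊆
S` of vertices with shortened lists, and planarity by the condition that `G` on `S`, together with
an apex joined to `X`, has no `K₅` minor. Contracting deleted vertices into the apex keeps this
condition.

`EdgeExtendable` and `FourFiveColorable` are proved together by induction on `S`. Suppose first that
a colouring of `x`, `y` is to be extended and `X` has further vertices. If one of these is sparse,
two of its colours can be reserved and the vertex deleted. If none is, a longest-path argument
yields a cycle in `X`. A shortest such cycle has no chord, so if it covers `X`, a cycle neighbour of
`x` is sparse after all. Otherwise some `t ∈ X` lies off the cycle. Its component `D` off the cycle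
attaches to at most two cycle vertices: with three attachments, the apex, `D` and three arcs would
form a `K₅`. The graph then splits along the attachments, and the colourings of the two sides are
glued.

If `X ⊆ {x, y}`, the apex is chosen afresh. A common neighbour of `x` and `y` can serve; when there
is none, `x` and `y` merge into the apex and every other vertex loses at most one colour, which is
the situation of `FourFiveColorable`. That statement in turn reduces to `EdgeExtendable` when `X`
spans an edge, and to the deletion of one vertex when it does not. -/

/-- `B` is preconnected in `G`: a subset of `B` that is nonempty and closed under adjacency
inside `B` is all of `B`. -/
def PreconnOn {V : Type*} (G : SimpleGraph V) (B : Set V) : Prop :=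
  ∀ T : Set V, (∃ u ∈ B, u ∈ T) → (∀ u ∈ B, u ∈ T → ∀ v ∈ B, G.Adj u v → v ∈ T) → B ⊆ T

/-- A model of `K₅` in `H`. -/
def HasK5 {W : Type*} (H : SimpleGraph W) : Prop :=
  ∃ B : Fin 5 → Set W, (∀ i, H.PreconnOn (B i)) ∧ (∀ i j, i ≠ j → Disjoint (B i) (B j)) ∧
    ∀ i j, i ≠ j → ∃ x ∈ B i, ∃ y ∈ B j, H.Adj x y

/-- Like `IsMinor`, except that the branch set of an isolated vertex may be empty. -/
def IsWeakMinor {W W' : Type*} (H' : SimpleGraph W') (H : SimpleGraph W) : Prop :=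
  ∃ F : W' → Set W, (∀ i, H.PreconnOn (F i)) ∧ (∀ i j, i ≠ j → Disjoint (F i) (F j)) ∧
    ∀ i j, H'.Adj i j → ∃ x ∈ F i, ∃ y ∈ F j, H.Adj x y

/-! ### Connected sets, minors and the apex graph. -/

section Basic

variable {V W : Type*} {G : SimpleGraph V}

theorem preconnOn_of_subsingleton {B : Set V} (hB : B.Subsingleton) : G.PreconnOn B := by
  rintro T ⟨u, hu, huT⟩ - v hv
  rwa [hB hv hu]

theorem PreconnOn.union {B B' : Set V} (h : G.PreconnOn B) (h' : G.PreconnOn B') {u v : V}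
    (hu : u ∈ B) (hv : v ∈ B') (huv : G.Adj u v) : G.PreconnOn (B ∪ B') := by
  intro T hT hcl
  have hB : (∃ w ∈ B, w ∈ T) → B ⊆ T := fun hw => h T hw fun w hw hwT z hz =>
    hcl w (Or.inl hw) hwT z (Or.inl hz)
  have hB' : (∃ w ∈ B', w ∈ T) → B' ⊆ T := fun hw => h' T hw fun w hw hwT z hz =>
    hcl w (Or.inr hw) hwT z (Or.inr hz)
  have h1 : u ∈ T → v ∈ T := fun hT => hcl u (Or.inl hu) hT v (Or.inr hv) huv
  have h2 : v ∈ T → u ∈ T := fun hT => hcl v (Or.inr hv) hT u (Or.inl hu) huv.symm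
  obtain ⟨w, hw | hw, hwT⟩ := hT
  · have := hB ⟨w, hw, hwT⟩
    exact Set.union_subset this (hB' ⟨v, hv, h1 (this hu)⟩)
  · have := hB' ⟨w, hw, hwT⟩
    exact Set.union_subset (hB ⟨u, hu, h2 (this hv)⟩) this

theorem preconnOn_image_Ico {p : ℕ → V} (i : ℕ) {j : ℕ}
    (hp : ∀ m, i ≤ m → m + 1 < j → G.Adj (p m) (p (m + 1))) :
    G.PreconnOn (p '' Set.Ico i j) := by
  induction j with
  | zero => simpa using preconnOn_of_subsingleton (G := G) Set.subsingleton_empty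
  | succ j ih =>
    rcases lt_trichotomy i j with h | h | h
    · have : p '' Set.Ico i (j + 1) = p '' Set.Ico i j ∪ {p j} := by
        rw [← Set.image_singleton, ← Set.image_union]
        congr 1
        ext m
        simp
        omega
      rw [this]
      obtain ⟨k, rfl⟩ : ∃ k, j = k + 1 := ⟨j - 1, by omega⟩
      exact (ih fun m h1 h2 => hp m h1 (by omega)).union
        (preconnOn_of_subsingleton Set.subsingleton_singleton)
        ⟨k, ⟨by omega, by omega⟩, rfl⟩ rfl (hp k (by omega) (by omega))
    · subst h
      apply preconnOn_of_subsingleton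
      rw [show Set.Ico i (i + 1) = {i} by ext; simp; omega, Set.image_singleton]
      exact Set.subsingleton_singleton
    · rw [Set.Ico_eq_empty (by omega), Set.image_empty]
      exact preconnOn_of_subsingleton Set.subsingleton_empty

theorem PreconnOn.induce_preconnected {B : Set V} (h : G.PreconnOn B) :
    (G.induce B).Preconnected := by
  intro a b
  have := h {v | ∃ hv : v ∈ B, (G.induce B).Reachable a ⟨v, hv⟩} ⟨a, a.2, a.2, Reachable.refl _⟩ (by
    rintro u hu ⟨_, hau⟩ v hv huv
    exact ⟨hv, hau.trans (Adj.reachable (by simpa using huv))⟩)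
  exact (this b.2).2

/-- Composition of models: each branch set is replaced by the union of the branch sets of its
vertices. Empty ones do no harm, because adjacency inside a branch set only involves nonempty ones.
-/
theorem HasK5.of_isWeakMinor {H : SimpleGraph W} (hG : G.HasK5) (hm : G.IsWeakMinor H) :
    H.HasK5 := by
  obtain ⟨B, hB, hd, ha⟩ := hG
  obtain ⟨F, hF, hFd, hFa⟩ := hm
  refine ⟨fun i => ⋃ w ∈ B i, F w, fun i T hT hcl => ?_, fun i j hij => ?_, fun i j hij => ?_⟩
  · have hw : ∀ w ∈ B i, (∃ x ∈ F w, x ∈ T) → F w ⊆ T := fun w hw hx =>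
      hF w T hx fun x hx hxT y hy => hcl x (Set.mem_biUnion hw hx) hxT y (Set.mem_biUnion hw hy)
    have := hB i {w | ∃ x ∈ F w, x ∈ T} (by
        obtain ⟨x, hx, hxT⟩ := hT
        simp only [Set.mem_iUnion] at hx
        obtain ⟨w, hw, hx⟩ := hx
        exact ⟨w, hw, x, hx, hxT⟩) (by
      intro u hu huT v hv huv
      obtain ⟨x, hx, y, hy, hxy⟩ := hFa u v huv
      exact ⟨y, hy, hcl x (Set.mem_biUnion hu hx) (hw u hu huT hx) y (Set.mem_biUnion hv hy) hxy⟩)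
    exact Set.iUnion₂_subset fun w hwB => hw w hwB (this hwB)
  · simp only [Set.disjoint_iUnion_left, Set.disjoint_iUnion_right]
    intro w hw z hz
    exact hFd _ _ fun h => Set.disjoint_left.1 (hd i j hij) hz (h ▸ hw)
  · obtain ⟨u, hu, v, hv, huv⟩ := ha i j hij
    obtain ⟨x, hx, y, hy, hxy⟩ := hFa u v huv
    exact ⟨x, Set.mem_biUnion hu hx, y, Set.mem_biUnion hv hy, hxy⟩

/-- The subgraph of `G` induced on `S` together with a new vertex `none` joined to `X`. -/
def apex (G : SimpleGraph V) (S X : Set V) : SimpleGraph (Option V) where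
  Adj
    | some u, some v => u ∈ S ∧ v ∈ S ∧ G.Adj u v
    | none, some v => v ∈ X
    | some v, none => v ∈ X
    | none, none => False
  symm := ⟨by
    rintro (_ | u) (_ | v) h
    · exact h
    · exact h
    · exact h
    · exact ⟨h.2.1, h.1, h.2.2.symm⟩⟩
  loopless := ⟨by
    rintro (_ | u) h
    · exact h
    · exact G.loopless.irrefl u h.2.2⟩

variable {S X : Set V}

theorem PreconnOn.image_some {B : Set V} (h : G.PreconnOn B) (hB : B ⊆ S) :
    (G.apex S X).PreconnOn (some '' B) := by
  rintro T ⟨_, ⟨u, hu, rfl⟩, huT⟩ hcl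
  have := h (some ⁻¹' T) ⟨u, hu, huT⟩ fun u hu huT v hv huv =>
    hcl _ ⟨u, hu, rfl⟩ huT _ ⟨v, hv, rfl⟩ ⟨hB hu, hB hv, huv⟩
  rintro _ ⟨v, hv, rfl⟩
  exact this hv

/-- A weak minor of `apex G S X` on a subset `S'` of `S` given by a branch set for `none` and one
for each vertex of `S'`. -/
theorem isWeakMinor_apex {G' : SimpleGraph V} {S' X' : Set V} (hX' : X' ⊆ S')
    (N : Set (Option V)) (F : V → Set V) (hN : (G.apex S X).PreconnOn N)
    (hF : ∀ v ∈ S', G.PreconnOn (F v)) (hFS : ∀ v ∈ S', F v ⊆ S)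
    (hNF : ∀ v ∈ S', ∀ x ∈ F v, some x ∉ N)
    (hd : ∀ u ∈ S', ∀ v ∈ S', u ≠ v → Disjoint (F u) (F v))
    (hNX : ∀ v ∈ X', ∃ x ∈ N, ∃ y ∈ F v, (G.apex S X).Adj x (some y))
    (ha : ∀ u ∈ S', ∀ v ∈ S', G'.Adj u v → ∃ x ∈ F u, ∃ y ∈ F v, G.Adj x y) :
    (G'.apex S' X').IsWeakMinor (G.apex S X) := by
  refine ⟨fun o => o.elim N fun v => {x | v ∈ S' ∧ x ∈ some '' F v}, ?_, ?_, ?_⟩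
  · rintro (_ | v)
    · exact hN
    · by_cases hv : v ∈ S'
      · simpa [hv, Set.image] using (hF v hv).image_some (X := X) (hFS v hv)
      · simpa [hv] using preconnOn_of_subsingleton Set.subsingleton_empty
  · rintro (_ | u) (_ | v) h
    · exact (h rfl).elim
    · refine Set.disjoint_left.2 ?_
      rintro _ hx ⟨hv, x, hxv, rfl⟩
      exact hNF v hv x hxv hx
    · refine Set.disjoint_left.2 ?_
      rintro _ ⟨hv, x, hxv, rfl⟩ hx
      exact hNF u hv x hxv hx
    · refine Set.disjoint_left.2 ?_
      rintro _ ⟨hu, x, hxu, rfl⟩ ⟨hv, y, hyv, hxy⟩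
      obtain rfl : y = x := Option.some.inj hxy
      exact Set.disjoint_left.1 (hd u hu v hv fun h' => h (h' ▸ rfl)) hxu hyv
  · have key : ∀ v ∈ X', ∃ x ∈ N, ∃ y ∈ {x : Option V | v ∈ S' ∧ x ∈ some '' F v},
        (G.apex S X).Adj x y := by
      intro v hv
      obtain ⟨x, hx, y, hy, hxy⟩ := hNX v hv
      exact ⟨x, hx, some y, ⟨hX' hv, y, hy, rfl⟩, hxy⟩
    rintro (_ | u) (_ | v) h
    · exact h.elim
    · exact key v h
    · obtain ⟨x, hx, y, hy, hxy⟩ := key u h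
      exact ⟨y, hy, x, hx, hxy.symm⟩
    · obtain ⟨x, hx, y, hy, hxy⟩ := ha u h.1 v h.2.1 h.2.2
      exact ⟨some x, ⟨h.1, x, hx, rfl⟩, some y, ⟨h.2.1, y, hy, rfl⟩,
        hFS u h.1 hx, hFS v h.2.1 hy, hxy⟩

/-- Deleting the vertices in `S \ S'` while contracting those in a set `N` into the apex. -/
theorem isWeakMinor_apex_contract {S' X' : Set V} (hX' : X' ⊆ S') (hS : S' ⊆ S)
    (N : Set (Option V)) (hN : (G.apex S X).PreconnOn N) (hNS : ∀ v ∈ S', some v ∉ N)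
    (hNX : ∀ v ∈ X', ∃ x ∈ N, (G.apex S X).Adj x (some v)) :
    (G.apex S' X').IsWeakMinor (G.apex S X) := by
  refine isWeakMinor_apex hX' N (fun v => {v}) hN
    (fun v _ => preconnOn_of_subsingleton Set.subsingleton_singleton) ?_ ?_ ?_ ?_ ?_
  · simpa using fun v hv => hS hv
  · simpa using hNS
  · intro u _ v _ h
    simpa using h
  · simpa using hNX
  · intro u _ v _ h
    exact ⟨u, rfl, v, rfl, h⟩

theorem not_hasK5_apex_univ_empty (hG : ¬ IsMinor (completeGraph (Fin 5)) G) :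
    ¬ (G.apex Set.univ ∅).HasK5 := by
  rintro ⟨B, hB, hd, ha⟩
  -- The apex is isolated here, so it would be a whole branch set with no edge to the other four.
  have hnone : ∀ i, none ∉ B i := by
    intro i hi
    have hsub := hB i {none} ⟨none, hi, rfl⟩ (by
      rintro u - rfl (_ | v) - h
      · rfl
      · exact h.elim)
    obtain ⟨j, hj⟩ := exists_ne i
    obtain ⟨x, hx, y, hy, hxy⟩ := ha i j hj.symm
    obtain rfl := hsub hx
    cases y <;> exact hxy.elim
  refine hG ⟨fun i => some ⁻¹' B i, fun i => ?_, fun i j hij => ?_, fun i j hij => ?_⟩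
  · have hp : G.PreconnOn (some ⁻¹' B i) := by
      rintro T ⟨u, hu, huT⟩ hcl v hv
      have := hB i (some '' T) ⟨some u, hu, u, huT, rfl⟩ (by
        rintro _ hu ⟨u, huT, rfl⟩ (_ | v) hv huv
        · exact (hnone i hv).elim
        · exact ⟨v, hcl u hu huT v hv huv.2.2, rfl⟩)
      obtain ⟨v', hv', h⟩ := this hv
      exact Option.some.inj h ▸ hv'
    obtain ⟨j, hj⟩ := exists_ne i
    obtain ⟨x, hx, -⟩ := ha i j hj.symm
    obtain _ | x := x
    · exact (hnone i hx).elim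
    · have : Nonempty (some ⁻¹' B i) := ⟨⟨x, hx⟩⟩
      exact ⟨hp.induce_preconnected⟩
  · exact (hd i j hij).preimage _
  · obtain ⟨x, hx, y, hy, hxy⟩ := ha i j hij
    obtain _ | x := x
    · exact (hnone i hx).elim
    obtain _ | y := y
    · exact (hnone j hy).elim
    exact ⟨x, hx, y, hy, hxy.2.2⟩

end Basic

/-! ### Cycles inside `X` and sparse vertices. -/

/-- `p` runs periodically around a cycle of length `n` of `G` contained in `X`. -/
structure IsPeriodicCycle {V : Type*} (G : SimpleGraph V) (X : Set V) (n : ℕ) (p : ℕ → V) :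
    Prop where
  three_le : 3 ≤ n
  mem : ∀ i, p i ∈ X
  add_period : ∀ i, p (i + n) = p i
  adj : ∀ i, G.Adj (p i) (p (i + 1))
  ne : ∀ i j, i < j → j < i + n → p i ≠ p j

section Cycle

variable {V : Type*} {G : SimpleGraph V} {S X : Set V} {n : ℕ} {p : ℕ → V}

theorem exists_isPeriodicCycle {i j : ℕ} (hij : i + 2 ≤ j) (hX : ∀ m, i ≤ m → m ≤ j → p m ∈ X)
    (ha : ∀ m, i ≤ m → m < j → G.Adj (p m) (p (m + 1))) (hc : G.Adj (p j) (p i))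
    (hne : ∀ k l, i ≤ k → k < l → l ≤ j → p k ≠ p l) :
    ∃ q, G.IsPeriodicCycle X (j - i + 1) q := by
  have hn : 0 < j - i + 1 := by omega
  have hlt : ∀ m, m % (j - i + 1) < j - i + 1 := fun m => Nat.mod_lt _ hn
  have hinj : ∀ k l, k < j - i + 1 → l < j - i + 1 → p (i + k) = p (i + l) → k = l := by
    intro k l hk hl h
    rcases lt_trichotomy k l with h' | h' | h'
    · exact (hne (i + k) (i + l) (by omega) (by omega) (by omega) h).elim
    · exact h'
    · exact (hne (i + l) (i + k) (by omega) (by omega) (by omega) h.symm).elim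
  refine ⟨fun m => p (i + m % (j - i + 1)), by omega, fun m => ?_, fun m => ?_, fun m => ?_,
    fun k l hkl hl h => ?_⟩
  · have := hlt m
    exact hX _ (by omega) (by omega)
  · simp
  · have := hlt m
    rw [Nat.add_mod m 1, Nat.mod_eq_of_lt (show 1 < j - i + 1 by omega)]
    by_cases h : m % (j - i + 1) = j - i
    · rw [h, Nat.mod_self, show i + (j - i) = j by omega]
      exact hc
    · rw [Nat.mod_eq_of_lt (show m % (j - i + 1) + 1 < j - i + 1 by omega)]
      exact ha _ (by omega) (by omega)
  · have := hinj _ _ (hlt k) (hlt l) h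
    obtain ⟨d, rfl⟩ := Nat.exists_eq_add_of_lt hkl
    have h0 : k ≡ k + (d + 1) [MOD j - i + 1] := this
    have h1 : (d + 1) ≡ 0 [MOD j - i + 1] := (Nat.ModEq.add_left_cancel' k h0).symm
    have := Nat.le_of_dvd (by omega) ((Nat.modEq_zero_iff_dvd).1 h1)
    omega

namespace IsPeriodicCycle

theorem exists_between (h : G.IsPeriodicCycle X n p) (i m : ℕ) :
    ∃ k, i ≤ k ∧ k < i + n ∧ p k = p m := by
  have hper : ∀ a b, p (a + b * n) = p a := by
    intro a b
    induction b with
    | zero => simp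
    | succ b ih => rw [Nat.succ_mul, ← add_assoc, h.add_period, ih]
  have hn : 0 < n := by have := h.three_le; omega
  have h1 : p (m + i * n) = p m := hper m i
  have hle : i ≤ m + i * n := by nlinarith
  obtain ⟨d, hd⟩ := Nat.exists_eq_add_of_le hle
  refine ⟨i + d % n, by omega, by have := Nat.mod_lt d hn; omega, ?_⟩
  rw [← h1, hd, ← hper (i + d % n) (d / n), add_assoc, Nat.mod_add_div']

/-- A shortest cycle has no chord, since a chord closes an arc to a shorter cycle. -/
theorem eq_of_adj (h : G.IsPeriodicCycle X n p)
    (hmin : ∀ m q, G.IsPeriodicCycle X m q → n ≤ m) {i m : ℕ} (ha : G.Adj (p i) (p m)) :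
    p m = p (i + 1) ∨ p m = p (i + n - 1) := by
  obtain ⟨k, hk, hkn, hpk⟩ := h.exists_between i m
  rw [← hpk] at ha ⊢
  rcases hk.eq_or_lt with rfl | hk
  · exact (ha.ne rfl).elim
  by_cases h1 : k = i + 1
  · exact Or.inl (h1 ▸ rfl)
  obtain ⟨q, hq⟩ := exists_isPeriodicCycle (G := G) (X := X) (p := p) (i := i) (j := k) (by omega)
    (fun m _ _ => h.mem m) (fun m _ _ => h.adj m) ha.symm
    (fun k l hk hkl hl => h.ne k l hkl (by omega))
  have := hmin _ _ hq
  exact Or.inr (by rw [show k = i + n - 1 by omega])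

end IsPeriodicCycle

/-- The neighbours of `z` in `X` are among `x` or `y` and one further vertex. -/
def IsSparseAt (G : SimpleGraph V) (X : Set V) (x y z : V) : Prop :=
  ∃ a w, (a = x ∨ a = y) ∧ ∀ u ∈ X, G.Adj z u → u = a ∨ u = w

/-- A cycle neighbour of `x` has only `x` and one other vertex as neighbours in `X`, and `y` is at
most one of the two cycle neighbours of `x`. -/
theorem IsPeriodicCycle.exists_isSparseAt (h : G.IsPeriodicCycle X n p)
    (hmin : ∀ m q, G.IsPeriodicCycle X m q → n ≤ m) (hX : X ⊆ Set.range p) {x y : V}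
    (hx : x ∈ X) (hxy : x = y ∨ G.Adj x y) :
    ∃ z ∈ X, z ≠ x ∧ z ≠ y ∧ G.IsSparseAt X x y z := by
  have h3 := h.three_le
  obtain ⟨m, rfl⟩ := hX hx
  -- A positive index for `x` leaves room for its predecessor.
  obtain ⟨i, hi, -, him⟩ := h.exists_between 1 m
  rw [← him] at hxy ⊢
  obtain ⟨i, rfl⟩ : ∃ k, i = k + 1 := ⟨i - 1, by omega⟩
  by_cases hy : y = p (i + 2)
  · subst hy
    refine ⟨p i, h.mem _, h.ne _ _ (by omega) (by omega), h.ne _ _ (by omega) (by omega),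
      p (i + 1), p (i + n - 1), Or.inl rfl, fun u hu hzu => ?_⟩
    obtain ⟨k, rfl⟩ := hX hu
    exact h.eq_of_adj hmin hzu
  · refine ⟨p (i + 2), h.mem _, (h.ne _ _ (by omega) (by omega)).symm, fun h => hy h.symm,
      p (i + 1), p (i + 3), Or.inl rfl, fun u hu hzu => ?_⟩
    obtain ⟨k, rfl⟩ := hX hu
    have := h.eq_of_adj hmin hzu
    rw [show i + 2 + n - 1 = i + 1 + n by omega, h.add_period] at this
    exact this.symm

/-- Take a longest path in `X` avoiding `x` and `y`. If `X` has no cycle, the last vertex has no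
neighbour in `X` besides its predecessor, `x` and `y`; it is not adjacent to both ends of an edge
`xy`, which would make a triangle, so it is sparse. -/
theorem exists_isSparseAt_or_isPeriodicCycle [Finite V] {x y : V} (hx : x ∈ X) (hy : y ∈ X)
    (hxy : x = y ∨ G.Adj x y) (hne : ∃ z ∈ X, z ≠ x ∧ z ≠ y) :
    (∃ z ∈ X, z ≠ x ∧ z ≠ y ∧ G.IsSparseAt X x y z) ∨ ∃ n p, G.IsPeriodicCycle X n p := by
  by_contra! hcon
  obtain ⟨hgood, hcyc⟩ := hcon
  let P : ℕ → Prop := fun n => ∃ p : ℕ → V, (∀ i ≤ n, p i ∈ X ∧ p i ≠ x ∧ p i ≠ y) ∧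
    (∀ i < n, G.Adj (p i) (p (i + 1))) ∧ ∀ i j, i < j → j ≤ n → p i ≠ p j
  have hbound : ∀ n, P n → n ≤ Nat.card V := by
    rintro n ⟨p, -, -, hp⟩
    have hinj : Function.Injective fun i : Fin n => p i := by
      intro i j hij
      rcases lt_trichotomy i j with h | h | h
      · exact (hp i j h (by omega) hij).elim
      · exact h
      · exact (hp j i h (by omega) hij.symm).elim
    simpa using Nat.card_le_card_of_injective _ hinj
  obtain ⟨t, ht, htx, hty⟩ := hne
  have h0 : P 0 := ⟨fun _ => t, fun _ _ => ⟨ht, htx, hty⟩, fun i hi => by omega,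
    fun i j hi hj => by omega⟩
  obtain ⟨n, ⟨p, hpX, hpa, hpn⟩, hmax⟩ : ∃ n, P n ∧ ∀ m, P m → m ≤ n := by
    classical
    exact ⟨_, Nat.findGreatest_spec (P := P) (Nat.zero_le _) h0,
      fun m hm => Nat.le_findGreatest (hbound m hm) hm⟩
  obtain ⟨hzX, hzx, hzy⟩ := hpX n le_rfl
  have hnb : ∀ u ∈ X, u ≠ x → u ≠ y → G.Adj (p n) u → u = p (n - 1) := by
    intro u hu hux huy hzu
    by_cases hup : ∃ m ≤ n, p m = u
    · obtain ⟨m, hm, rfl⟩ := hup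
      rcases hm.eq_or_lt with rfl | hm
      · exact (hzu.ne rfl).elim
      by_contra hne
      have hm1 : m ≠ n - 1 := fun h => hne (h ▸ rfl)
      obtain ⟨q, hq⟩ := exists_isPeriodicCycle (G := G) (X := X) (p := p) (i := m) (j := n)
        (by omega) (fun k _ hk => (hpX k hk).1) (fun k _ hk => hpa k hk) hzu
        (fun k l _ hkl hl => hpn k l hkl hl)
      exact hcyc _ _ hq
    · push Not at hup
      have : P (n + 1) := by
        refine ⟨fun i => if i ≤ n then p i else u, fun i hi => ?_, fun i hi => ?_,
          fun i j hij hj => ?_⟩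
        · by_cases h : i ≤ n
          · simpa [h] using hpX i h
          · simp [h, hu, hux, huy]
        · by_cases h : i + 1 ≤ n
          · simpa [h, show i ≤ n by omega] using hpa i (by omega)
          · obtain rfl : i = n := by omega
            simpa using hzu
        · by_cases h : j ≤ n
          · simpa [h, show i ≤ n by omega] using hpn i j hij h
          · simpa [h, show i ≤ n by omega] using hup i (by omega)
      have := hmax _ this
      omega
  have hsparse : ∀ a, (a = x ∨ a = y) →
      ¬ ∀ u, (u = x ∨ u = y) → G.Adj (p n) u → u = a := by
    intro a ha hu
    refine hgood _ hzX hzx hzy ⟨a, p (n - 1), ha, fun u huX hzu => ?_⟩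
    by_cases h : u = x ∨ u = y
    · exact Or.inl (hu u h hzu)
    · push Not at h
      exact Or.inr (hnb u huX h.1 h.2 hzu)
  have hax : G.Adj (p n) x := by
    by_contra h
    refine hsparse y (Or.inr rfl) ?_
    rintro u (rfl | rfl) hu
    · exact (h hu).elim
    · rfl
  have hay : G.Adj (p n) y := by
    by_contra h
    refine hsparse x (Or.inl rfl) ?_
    rintro u (rfl | rfl) hu
    · rfl
    · exact (h hu).elim
  rcases hxy with rfl | hxy
  · exact hsparse x (Or.inl rfl) fun u hu _ => hu.elim id id
  -- The triangle formed by `x`, `y` and the end of the path.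
  · let q : ℕ → V := fun i => if i = 0 then x else if i = 1 then y else p n
    obtain ⟨q, hq⟩ := exists_isPeriodicCycle (G := G) (X := X) (p := q) (i := 0) (j := 2)
      le_rfl
      (fun m _ hm => by
        interval_cases m
        · simpa [q] using hx
        · simpa [q] using hy
        · simpa [q] using hzX)
      (fun m _ hm => by
        interval_cases m
        · simpa [q] using hxy
        · simpa [q] using hay.symm)
      (by simpa [q] using hax)
      (fun k l _ hkl hl => by
        interval_cases l <;> interval_cases k
        · simpa [q] using hxy.ne
        · simpa [q] using hzx.symm
        · simpa [q] using hzy.symm)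
    exact hcyc _ _ hq

/-! ### Connected sets attached to a cycle. -/

theorem hasK5_of_lt {W : Type*} {H : SimpleGraph W} (B : Fin 5 → Set W)
    (hB : ∀ i, H.PreconnOn (B i)) (hd : ∀ i j, i < j → Disjoint (B i) (B j))
    (ha : ∀ i j, i < j → ∃ x ∈ B i, ∃ y ∈ B j, H.Adj x y) : H.HasK5 := by
  refine ⟨B, hB, fun i j hij => ?_, fun i j hij => ?_⟩
  · rcases hij.lt_or_gt with h | h
    · exact hd i j h
    · exact (hd j i h).symm
  · rcases hij.lt_or_gt with h | h
    · exact ha i j h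
    · obtain ⟨x, hx, y, hy, hxy⟩ := ha j i h
      exact ⟨y, hy, x, hx, hxy.symm⟩

/-- The branch sets are the apex, `D`, and the three arcs of the cycle that start at the
attachments. The vertex `t` supplies the edge from the apex to `D`. -/
theorem IsPeriodicCycle.hasK5 (h : G.IsPeriodicCycle X n p) (hXS : X ⊆ S) {D : Set V}
    (hDS : D ⊆ S) (hD : G.PreconnOn D) (hDp : ∀ i, p i ∉ D) {t : V} (htD : t ∈ D) (htX : t ∈ X)
    {i j k : ℕ} (hij : i < j) (hjk : j < k) (hki : k < i + n) (hi : ∃ u ∈ D, G.Adj u (p i))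
    (hj : ∃ u ∈ D, G.Adj u (p j)) (hk : ∃ u ∈ D, G.Adj u (p k)) : (G.apex S X).HasK5 := by
  have hpS : ∀ m, p m ∈ S := fun m => hXS (h.mem m)
  have harc : ∀ a b, (G.apex S X).PreconnOn (some '' (p '' Set.Ico a b)) := fun a b =>
    (preconnOn_image_Ico a fun m _ _ => h.adj m).image_some (by
      rintro _ ⟨m, -, rfl⟩
      exact hpS m)
  have hdisj : ∀ a b c d, b ≤ c → d ≤ a + n →
      Disjoint (some '' (p '' Set.Ico a b)) (some '' (p '' Set.Ico c d)) := by
    intro a b c d hbc hda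
    refine (Set.disjoint_image_iff (Option.some_injective V)).2 (Set.disjoint_left.2 ?_)
    rintro _ ⟨l, hl, rfl⟩ ⟨m, hm, hlm⟩
    have := hl.1
    have := hl.2
    have := hm.1
    have := hm.2
    exact h.ne l m (by omega) (by omega) hlm.symm
  have hdD : ∀ a b, Disjoint (some '' D) (some '' (p '' Set.Ico a b)) := by
    intro a b
    refine (Set.disjoint_image_iff (Option.some_injective V)).2 (Set.disjoint_right.2 ?_)
    rintro _ ⟨l, -, rfl⟩
    exact hDp l
  have hdN : ∀ B : Set V, Disjoint {none} (some '' B) := by simp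
  have hmem : ∀ a b, a < b → some (p a) ∈ some '' (p '' Set.Ico a b) := fun a b hab =>
    ⟨_, ⟨a, ⟨le_rfl, hab⟩, rfl⟩, rfl⟩
  have haN : ∀ a b, a < b → ∃ x ∈ ({none} : Set (Option V)), ∃ y ∈ some '' (p '' Set.Ico a b),
      (G.apex S X).Adj x y := fun a b hab => ⟨_, rfl, _, hmem a b hab, h.mem a⟩
  have haD : ∀ a b, a < b → (∃ u ∈ D, G.Adj u (p a)) → ∃ x ∈ some '' D,
      ∃ y ∈ some '' (p '' Set.Ico a b), (G.apex S X).Adj x y := by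
    rintro a b hab ⟨u, hu, hua⟩
    exact ⟨_, ⟨u, hu, rfl⟩, _, hmem a b hab, hDS hu, hpS a, hua⟩
  have haa : ∀ a b c, a < b → b < c → ∃ x ∈ some '' (p '' Set.Ico a b),
      ∃ y ∈ some '' (p '' Set.Ico b c), (G.apex S X).Adj x y := by
    intro a b c hab hbc
    obtain ⟨b, rfl⟩ : ∃ m, b = m + 1 := ⟨b - 1, by omega⟩
    exact ⟨_, ⟨_, ⟨b, ⟨by omega, by omega⟩, rfl⟩, rfl⟩, _, hmem _ _ hbc, hpS _, hpS _, h.adj b⟩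
  have hac : ∃ x ∈ some '' (p '' Set.Ico i j), ∃ y ∈ some '' (p '' Set.Ico k (i + n)),
      (G.apex S X).Adj x y := by
    -- The third arc closes up with the first one: `p (i + n)` is `p i`.
    refine ⟨_, hmem i j hij, _, ⟨_, ⟨i + n - 1, ⟨by omega, by omega⟩, rfl⟩, rfl⟩, hpS _, hpS _, ?_⟩
    have := h.adj (i + n - 1)
    rw [show i + n - 1 + 1 = i + n by omega, h.add_period] at this
    exact this.symm
  refine hasK5_of_lt ![{none}, some '' D, some '' (p '' Set.Ico i j), some '' (p '' Set.Ico j k),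
    some '' (p '' Set.Ico k (i + n))] ?_ ?_ ?_
  · intro m
    fin_cases m
    · exact preconnOn_of_subsingleton Set.subsingleton_singleton
    · exact hD.image_some hDS
    · exact harc i j
    · exact harc j k
    · exact harc k (i + n)
  · intro l m hlm
    fin_cases l <;> fin_cases m <;> first | exact absurd hlm (by decide) | skip
    · exact hdN _
    · exact hdN _
    · exact hdN _
    · exact hdN _
    · exact hdD _ _
    · exact hdD _ _
    · exact hdD _ _
    · exact hdisj _ _ _ _ le_rfl (by omega)
    · exact hdisj _ _ _ _ hjk.le le_rfl
    · exact hdisj _ _ _ _ le_rfl (by omega)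
  · intro l m hlm
    fin_cases l <;> fin_cases m <;> first | exact absurd hlm (by decide) | skip
    · exact ⟨none, rfl, some t, ⟨t, htD, rfl⟩, htX⟩
    · exact haN _ _ hij
    · exact haN _ _ hjk
    · exact haN _ _ hki
    · exact haD _ _ hij hi
    · exact haD _ _ hjk hj
    · exact haD _ _ hki hk
    · exact haa _ _ _ hij hjk
    · exact hac
    · exact haa _ _ _ hjk hki

/-- The component of `t` in the subgraph of `G` induced on `R`. -/
theorem exists_preconnOn_closed {R : Set V} {t : V} (ht : t ∈ R) :
    ∃ D ⊆ R, t ∈ D ∧ G.PreconnOn D ∧ ∀ u ∈ D, ∀ v ∈ R, G.Adj u v → v ∈ D := by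
  refine ⟨⋃₀ {B | B ⊆ R ∧ t ∈ B ∧ G.PreconnOn B}, Set.sUnion_subset fun B hB => hB.1,
    ⟨{t}, ⟨by simpa, rfl, preconnOn_of_subsingleton Set.subsingleton_singleton⟩, rfl⟩, ?_, ?_⟩
  · rintro T ⟨u, ⟨B, hB, huB⟩, huT⟩ hcl
    have key : ∀ B', B' ⊆ R ∧ t ∈ B' ∧ G.PreconnOn B' → (∃ x ∈ B', x ∈ T) → B' ⊆ T :=
      fun B' hB' hx => hB'.2.2 T hx fun u hu huT v hv huv =>
        hcl u ⟨B', hB', hu⟩ huT v ⟨B', hB', hv⟩ huv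
    have htT : t ∈ T := key B hB ⟨u, huB, huT⟩ hB.2.1
    exact Set.sUnion_subset fun B' hB' => key B' hB' ⟨t, hB'.2.1, htT⟩
  · rintro u ⟨B, ⟨hBR, htB, hB⟩, huB⟩ v hv huv
    exact ⟨B ∪ {v}, ⟨Set.union_subset hBR (by simpa), Or.inl htB,
      hB.union (preconnOn_of_subsingleton Set.subsingleton_singleton) huB rfl huv⟩, Or.inr rfl⟩

/-- Only two vertices of a cycle in `X` can be joined to a connected set outside the cycle that
meets `X`. -/
theorem IsPeriodicCycle.exists_attachment (h : G.IsPeriodicCycle X n p) (hXS : X ⊆ S)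
    (hK : ¬ (G.apex S X).HasK5) {D : Set V} (hDS : D ⊆ S) (hD : G.PreconnOn D)
    (hDp : ∀ i, p i ∉ D) {t : V} (htD : t ∈ D) (htX : t ∈ X) :
    ∃ i j, i ≤ j ∧ j < i + n ∧ (∀ m, (∃ u ∈ D, G.Adj u (p m)) → p m = p i ∨ p m = p j) ∧
      (i = j ∨ (∃ u ∈ D, G.Adj u (p i)) ∧ ∃ u ∈ D, G.Adj u (p j)) := by
  have h3 := h.three_le
  by_cases h1 : ∃ i, ∃ u ∈ D, G.Adj u (p i)
  · obtain ⟨i, hi⟩ := h1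
    by_cases h2 : ∃ j, i < j ∧ j < i + n ∧ ∃ u ∈ D, G.Adj u (p j)
    · obtain ⟨j, hij, hjn, hj⟩ := h2
      refine ⟨i, j, hij.le, hjn, fun m hm => ?_, Or.inr ⟨hi, hj⟩⟩
      obtain ⟨k, hk, hkn, hkm⟩ := h.exists_between i m
      rw [← hkm] at hm ⊢
      by_contra! hne
      have hki : k ≠ i := fun h => hne.1 (h ▸ rfl)
      have hkj : k ≠ j := fun h => hne.2 (h ▸ rfl)
      rcases hkj.lt_or_gt with hkj | hkj
      · exact hK (h.hasK5 hXS hDS hD hDp htD htX (by omega) hkj hjn hi hm hj)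
      · exact hK (h.hasK5 hXS hDS hD hDp htD htX hij hkj hkn hi hj hm)
    · refine ⟨i, i, le_rfl, by omega, fun m hm => ?_, Or.inl rfl⟩
      obtain ⟨k, hk, hkn, hkm⟩ := h.exists_between i m
      rw [← hkm] at hm ⊢
      rcases hk.eq_or_lt with rfl | hk
      · exact Or.inl rfl
      · exact (h2 ⟨k, hk, hkn, hm⟩).elim
  · exact ⟨0, 0, le_rfl, by omega, fun m hm => (h1 ⟨m, hm⟩).elim, Or.inl rfl⟩

end Cycle

/-! ### The two inductive statements and the minors they use. -/

section Coloring

variable {V : Type u} {C : Type w} {G : SimpleGraph V} {S X : Set V}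

/-- Colourings of `x` and `y` in `X` extend to `S`, given lists of three colours on `X` and of five
colours elsewhere. -/
def EdgeExtendable (V : Type u) (C : Type w) (S : Set V) : Prop :=
  ∀ (G : SimpleGraph V) (X : Set V) (x y : V) (L : V → Finset C) (φ : V → C), X ⊆ S → x ∈ X →
    y ∈ X → (x = y ∨ G.Adj x y ∧ φ x ≠ φ y) → ¬ (G.apex S X).HasK5 →
    (∀ v ∈ X, v ≠ x → v ≠ y → 3 ≤ (L v).card) → (∀ v ∈ S, v ∉ X → 5 ≤ (L v).card) →
    ∃ c : V → C, (∀ u ∈ S, ∀ v ∈ S, G.Adj u v → c u ≠ c v) ∧ c x = φ x ∧ c y = φ y ∧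
      ∀ v ∈ S, v ≠ x → v ≠ y → c v ∈ L v

/-- `S` can be coloured from lists of four colours on `X` and of five colours elsewhere. -/
def FourFiveColorable (V : Type u) (C : Type w) (S : Set V) : Prop :=
  ∀ (G : SimpleGraph V) (X : Set V) (L : V → Finset C), X ⊆ S → ¬ (G.apex S X).HasK5 →
    (∀ v ∈ X, 4 ≤ (L v).card) → (∀ v ∈ S, v ∉ X → 5 ≤ (L v).card) →
    ∃ c : V → C, (∀ u ∈ S, ∀ v ∈ S, G.Adj u v → c u ≠ c v) ∧ ∀ v ∈ S, c v ∈ L v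

/-- Contracting `z` into the apex makes the neighbours of `z` adjacent to it. -/
theorem isWeakMinor_apex_delete (hXS : X ⊆ S) {z : V} (hz : z ∈ X) :
    (G.apex (S \ {z}) (X \ {z} ∪ {v ∈ S | G.Adj z v})).IsWeakMinor (G.apex S X) := by
  refine isWeakMinor_apex_contract ?_ Set.sdiff_subset ({none} ∪ {some z}) ?_ ?_ ?_
  · rintro v (hv | hv)
    · exact ⟨hXS hv.1, hv.2⟩
    · exact ⟨hv.1, hv.2.ne'⟩
  · exact (preconnOn_of_subsingleton Set.subsingleton_singleton).union
      (preconnOn_of_subsingleton Set.subsingleton_singleton) rfl rfl hz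
  · rintro v hv (h | h)
    · cases h
    · exact hv.2 (Option.some.inj h)
  · rintro v (hv | hv)
    · exact ⟨none, Or.inl rfl, hv.1⟩
    · exact ⟨some z, Or.inr rfl, hXS hz, hv.1, hv.2⟩

/-- The old apex is dropped and `z` takes its place. -/
theorem isWeakMinor_apex_star {z : V} (hz : z ∈ S) :
    (G.apex (S \ {z}) {v ∈ S | G.Adj z v}).IsWeakMinor (G.apex S X) := by
  refine isWeakMinor_apex_contract ?_ Set.sdiff_subset {some z}
    (preconnOn_of_subsingleton Set.subsingleton_singleton) ?_ ?_
  · rintro v hv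
    exact ⟨hv.1, hv.2.ne'⟩
  · rintro v hv h
    exact hv.2 (Option.some.inj h)
  · rintro v hv
    exact ⟨some z, rfl, hz, hv.1, hv.2⟩

/-- Contracting a connected set `K` onto `a` creates the edge `ab` if `K` is joined to `b`. -/
theorem isWeakMinor_apex_edge {S' X' K : Set V} {a b : V} (hX' : X' ⊆ S') (hXX : X' ⊆ X)
    (hS : S' ⊆ S) (hK : G.PreconnOn K) (hKS : K ⊆ S) (ha : a ∈ K)
    (hKS' : ∀ v ∈ K, v ∈ S' → v = a) (hb : a = b ∨ ∃ u ∈ K, G.Adj u b) :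
    ((G ⊔ edge a b).apex S' X').IsWeakMinor (G.apex S X) := by
  classical
  have hself : ∀ v, v ∈ if v = a then K else {v} := by
    intro v
    by_cases h : v = a
    · subst h
      simpa
    · simp [h]
  have hab : ∀ u v, u = a → v = b → u ≠ v → ∃ x ∈ (if u = a then K else {u} : Set V),
      ∃ y ∈ (if v = a then K else {v} : Set V), G.Adj x y := by
    rintro _ _ rfl rfl hne
    obtain ⟨w, hw, hwb⟩ := hb.resolve_left hne
    exact ⟨w, by simpa using hw, _, hself _, hwb⟩
  refine isWeakMinor_apex hX' {none} (fun v => if v = a then K else {v})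
    (preconnOn_of_subsingleton Set.subsingleton_singleton) ?_ ?_ ?_ ?_ ?_ ?_
  · intro v _
    by_cases h : v = a
    · simpa [h]
    · simpa [h] using preconnOn_of_subsingleton Set.subsingleton_singleton
  · intro v hv
    by_cases h : v = a
    · simpa [h]
    · simpa [h] using hS hv
  · simp
  · intro u hu v hv huv
    by_cases h : u = a
    · have hva : v ≠ a := fun h' => huv (h.trans h'.symm)
      simp only [h, if_true, hva, if_false, Set.disjoint_singleton_right]
      exact fun hvK => hva (hKS' v hvK hv)
    · by_cases h' : v = a
      · simp only [h, h', if_true, if_false, Set.disjoint_singleton_left]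
        exact fun huK => h (hKS' u huK hu)
      · simpa [h, h'] using huv
  · exact fun v hv => ⟨none, rfl, v, hself v, hXX hv⟩
  · rintro u hu v hv (h | h)
    · exact ⟨u, hself u, v, hself v, h⟩
    · obtain ⟨⟨rfl, rfl⟩ | ⟨rfl, rfl⟩, hne⟩ := (edge_adj ..).1 h
      · exact hab _ _ rfl rfl hne
      · obtain ⟨x, hx, y, hy, hxy⟩ := hab _ _ rfl rfl hne.symm
        exact ⟨y, hy, x, hx, hxy.symm⟩

/-! ### Reductions to smaller sets. -/

/-- `A`, which contains the precoloured vertices, is coloured first. If `a ≠ b`, the added edge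
makes their colours differ, so they can serve as the precoloured pair for `B`. -/
theorem exists_coloring_of_separation {A B : Set V} {a b x y : V} {L : V → Finset C} {φ : V → C}
    (hA : EdgeExtendable V C A) (hB : EdgeExtendable V C B) (hS : ∀ v ∈ S, v ∈ A ∨ v ∈ B)
    (hAS : A ⊆ S) (hBS : B ⊆ S) (haA : a ∈ A) (hbA : b ∈ A) (haB : a ∈ B) (hbB : b ∈ B)
    (haX : a ∈ X) (hbX : b ∈ X) (hAB : ∀ v ∈ A, v ∈ B → v = a ∨ v = b)
    (hsep : ∀ u ∈ A, u ∉ B → ∀ v ∈ B, v ∉ A → ¬ G.Adj u v)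
    (hKA : ¬ ((G ⊔ edge a b).apex A (X ∩ A)).HasK5) (hKB : ¬ ((G ⊔ edge a b).apex B (X ∩ B)).HasK5)
    (hx : x ∈ X) (hy : y ∈ X) (hxA : x ∈ A) (hyA : y ∈ A) (hxy : x = y ∨ G.Adj x y ∧ φ x ≠ φ y)
    (h3 : ∀ v ∈ X, v ≠ x → v ≠ y → 3 ≤ (L v).card) (h5 : ∀ v ∈ S, v ∉ X → 5 ≤ (L v).card) :
    ∃ c : V → C, (∀ u ∈ S, ∀ v ∈ S, G.Adj u v → c u ≠ c v) ∧ c x = φ x ∧ c y = φ y ∧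
      ∀ v ∈ S, v ≠ x → v ≠ y → c v ∈ L v := by
  classical
  obtain ⟨c, hc, hcx, hcy, hcL⟩ := hA (G ⊔ edge a b) (X ∩ A) x y L φ Set.inter_subset_right
    ⟨hx, hxA⟩ ⟨hy, hyA⟩ (hxy.imp_right fun h => ⟨Or.inl h.1, h.2⟩) hKA (fun v hv => h3 v hv.1)
    (fun v hv hvX => h5 v (hAS hv) fun h => hvX ⟨h, hv⟩)
  have hab : a = b ∨ (G ⊔ edge a b).Adj a b ∧ c a ≠ c b := by
    by_cases hab : a = b
    · exact Or.inl hab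
    · have : (G ⊔ edge a b).Adj a b := Or.inr ((edge_adj ..).2 ⟨Or.inl ⟨rfl, rfl⟩, hab⟩)
      exact Or.inr ⟨this, hc a haA b hbA this⟩
  have hout : ∀ v ∈ B, v ∉ A → v ≠ x ∧ v ≠ y ∧ v ≠ a ∧ v ≠ b := fun v _ hv =>
    ⟨fun h => hv (h ▸ hxA), fun h => hv (h ▸ hyA), fun h => hv (h ▸ haA), fun h => hv (h ▸ hbA)⟩
  have hin : ∀ v ∈ B, v ≠ a → v ≠ b → v ∉ A := fun v hv ha hb hvA =>
    (hAB v hvA hv).elim ha hb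
  obtain ⟨d, hd, hda, hdb, hdL⟩ := hB (G ⊔ edge a b) (X ∩ B) a b L c Set.inter_subset_right
    ⟨haX, haB⟩ ⟨hbX, hbB⟩ hab hKB
    (fun v hv ha hb => by
      have := hout v hv.2 (hin v hv.2 ha hb)
      exact h3 v hv.1 this.1 this.2.1)
    (fun v hv hvX => h5 v (hBS hv) fun h => hvX ⟨h, hv⟩)
  have hdB : ∀ v ∈ A, v ∈ B → d v = c v := by
    intro v hvA hvB
    obtain rfl | rfl := hAB v hvA hvB
    · exact hda
    · exact hdb
  have hor : ∀ u ∈ A, ∀ v ∈ B, v ∉ A → G.Adj u v → c u ≠ d v := by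
    intro u hu v hv hvA huv
    by_cases huB : u ∈ B
    · rw [← hdB u hu huB]
      exact hd u huB v hv (Or.inl huv)
    · exact (hsep u hu huB v hv hvA huv).elim
  refine ⟨fun v => if v ∈ A then c v else d v, fun u hu v hv huv => ?_, ?_, ?_,
    fun v hv hvx hvy => ?_⟩
  · by_cases huA : u ∈ A <;> by_cases hvA : v ∈ A
    · simpa [huA, hvA] using hc u huA v hvA (Or.inl huv)
    · simpa [huA, hvA] using hor u huA v ((hS v hv).resolve_left hvA) hvA huv
    · simpa [huA, hvA] using (hor v hvA u ((hS u hu).resolve_left huA) huA huv.symm).symm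
    · simpa [huA, hvA] using hd u ((hS u hu).resolve_left huA) v ((hS v hv).resolve_left hvA)
        (Or.inl huv)
  · simpa [hxA] using hcx
  · simpa [hyA] using hcy
  · by_cases hvA : v ∈ A
    · simpa [hvA] using hcL v hvA hvx hvy
    · have hvB := (hS v hv).resolve_left hvA
      have := hout v hvB hvA
      simpa [hvA] using hdL v hvB this.2.2.1 this.2.2.2

/-- The component `D` of `t` off the cycle, together with its attachments `p i` and `p j`, is one
side of a separation; the other is `S \ D`. If the attachments are distinct, the added edge between
them comes from contracting an arc of the cycle on the side of `D`, and from contracting `D` on the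
other side. -/
theorem exists_coloring_of_isPeriodicCycle {n : ℕ} {p : ℕ → V} {x y t : V} {L : V → Finset C}
    {φ : V → C} (ih : ∀ S', S' ⊂ S → EdgeExtendable V C S') (h : G.IsPeriodicCycle X n p)
    (hXS : X ⊆ S) (htX : t ∈ X) (ht : ∀ i, p i ≠ t) (hK : ¬ (G.apex S X).HasK5)
    (hx : x ∈ X) (hy : y ∈ X) (hxy : x = y ∨ G.Adj x y ∧ φ x ≠ φ y)
    (h3 : ∀ v ∈ X, v ≠ x → v ≠ y → 3 ≤ (L v).card) (h5 : ∀ v ∈ S, v ∉ X → 5 ≤ (L v).card) :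
    ∃ c : V → C, (∀ u ∈ S, ∀ v ∈ S, G.Adj u v → c u ≠ c v) ∧ c x = φ x ∧ c y = φ y ∧
      ∀ v ∈ S, v ≠ x → v ≠ y → c v ∈ L v := by
  have hn := h.three_le
  obtain ⟨D, hDR, htD, hD, hDcl⟩ := exists_preconnOn_closed (G := G) (R := S \ Set.range p) (t := t)
    ⟨hXS htX, by rintro ⟨i, hi⟩; exact ht i hi⟩
  have hDS : D ⊆ S := fun v hv => (hDR hv).1
  have hDp : ∀ i, p i ∉ D := fun i hi => (hDR hi).2 ⟨i, rfl⟩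
  obtain ⟨i, j, hij, hjn, hatt, hlink⟩ := h.exists_attachment hXS hK hDS hD hDp htD htX
  have hpS : ∀ m, p m ∈ S := fun m => hXS (h.mem m)
  have hpD : ∀ u ∈ D, ∀ v ∈ S, v ∉ D → G.Adj u v → v = p i ∨ v = p j := by
    intro u hu v hv hvD huv
    by_cases hvp : v ∈ Set.range p
    · obtain ⟨m, rfl⟩ := hvp
      exact hatt m ⟨u, hu, huv⟩
    · exact (hvD (hDcl u hu v ⟨hv, hvp⟩ huv)).elim
  let A : Set V := D ∪ {p i, p j}
  let B : Set V := S \ D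
  have hAS : A ⊆ S := by
    rintro v (hv | rfl | rfl)
    · exact hDS hv
    · exact hpS i
    · exact hpS j
  have hKA : ¬ ((G ⊔ edge (p i) (p j)).apex A (X ∩ A)).HasK5 := by
    -- The arc stops just before `p j`; the maximum keeps `p i` in it when `i = j`.
    refine fun h5 => hK (h5.of_isWeakMinor (isWeakMinor_apex_edge (K := p '' Set.Ico i (max j (i + 1)))
      Set.inter_subset_right Set.inter_subset_left hAS (preconnOn_image_Ico i fun m _ _ => h.adj m)
      ?_ ⟨i, ⟨le_rfl, by omega⟩, rfl⟩ ?_ ?_))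
    · rintro _ ⟨m, -, rfl⟩
      exact hpS m
    · rintro _ ⟨m, ⟨hm, hmj⟩, rfl⟩ (hv | hv | hv)
      · exact (hDp m hv).elim
      · exact hv
      · by_contra hne
        have hmi : m ≠ i := fun h => hne (h ▸ rfl)
        exact h.ne m j (by omega) (by omega) hv
    · by_cases hij' : i = j
      · exact Or.inl (hij' ▸ rfl)
      · obtain ⟨k, rfl⟩ : ∃ k, j = k + 1 := ⟨j - 1, by omega⟩
        exact Or.inr ⟨p k, ⟨k, ⟨by omega, by omega⟩, rfl⟩, h.adj k⟩
  have hKB : ¬ ((G ⊔ edge (p i) (p j)).apex B (X ∩ B)).HasK5 := by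
    rcases hlink with rfl | ⟨⟨u, hu, hui⟩, u', hu', huj⟩
    · exact fun h5 => hK (h5.of_isWeakMinor (isWeakMinor_apex_edge (K := {p i})
        Set.inter_subset_right Set.inter_subset_left Set.sdiff_subset
        (preconnOn_of_subsingleton Set.subsingleton_singleton) (by simpa using hpS i) rfl
        (fun v hv _ => hv) (Or.inl rfl)))
    · refine fun h5 => hK (h5.of_isWeakMinor (isWeakMinor_apex_edge (K := D ∪ {p i})
        Set.inter_subset_right Set.inter_subset_left Set.sdiff_subset
        (hD.union (preconnOn_of_subsingleton Set.subsingleton_singleton) hu rfl hui)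
        (Set.union_subset hDS (by simpa using hpS i)) (Or.inr rfl) ?_
        (Or.inr ⟨u', Or.inl hu', huj⟩)))
      rintro v (hv | hv) hvB
      · exact (hvB.2 hv).elim
      · exact hv
  have hA : EdgeExtendable V C A := by
    -- `A` contains at most two of the at least three cycle vertices.
    refine ih A ⟨hAS, fun hSA => ?_⟩
    have key : ∀ m, p m = p i ∨ p m = p j := fun m => (hSA (hpS m)).resolve_left (hDp m)
    have h1 := key (i + 1)
    have h2 := key (i + 2)
    have e1 := h.ne i (i + 1) (by omega) (by omega)
    have e2 := h.ne i (i + 2) (by omega) (by omega)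
    have e3 := h.ne (i + 1) (i + 2) (by omega) (by omega)
    exact e3 ((h1.resolve_left e1.symm).trans (h2.resolve_left e2.symm).symm)
  have hB : EdgeExtendable V C B := ih B ⟨Set.sdiff_subset, fun h => (h (hDS htD)).2 htD⟩
  have hiA : p i ∈ A := Or.inr (Or.inl rfl)
  have hjA : p j ∈ A := Or.inr (Or.inr rfl)
  have hiB : p i ∈ B := ⟨hpS i, hDp i⟩
  have hjB : p j ∈ B := ⟨hpS j, hDp j⟩
  have hcap : ∀ v ∈ A, v ∈ B → v = p i ∨ v = p j := fun v hv hvB => hv.resolve_left hvB.2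
  have hcup : ∀ v ∈ S, v ∈ A ∨ v ∈ B := by
    intro v hv
    by_cases hvD : v ∈ D
    · exact Or.inl (Or.inl hvD)
    · exact Or.inr ⟨hv, hvD⟩
  have hsep : ∀ u ∈ A, u ∉ B → ∀ v ∈ B, v ∉ A → ¬ G.Adj u v := by
    intro u hu huB v hv hvA huv
    have huD : u ∈ D := by
      by_contra huD
      exact huB ⟨hAS hu, huD⟩
    exact hvA (Or.inr (hpD u huD v hv.1 hv.2 huv))
  have hDA : ∀ u ∈ D, ∀ v ∈ S, G.Adj u v → v ∈ A := by
    intro u hu v hv huv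
    by_cases hvD : v ∈ D
    · exact Or.inl hvD
    · exact Or.inr (hpD u hu v hv hvD huv)
  by_cases hcase : x ∈ D ∨ y ∈ D
  -- The edge `xy` cannot cross the separation, so the precoloured pair lies on one side.
  · have hxyA : x ∈ A ∧ y ∈ A := by
      rcases hxy with rfl | ⟨hxy, -⟩
      · exact ⟨Or.inl (or_self_iff.1 hcase), Or.inl (or_self_iff.1 hcase)⟩
      · rcases hcase with hxD | hyD
        · exact ⟨Or.inl hxD, hDA x hxD y (hXS hy) hxy⟩
        · exact ⟨hDA y hyD x (hXS hx) hxy.symm, Or.inl hyD⟩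
    exact exists_coloring_of_separation hA hB hcup hAS Set.sdiff_subset hiA hjA hiB hjB (h.mem i)
      (h.mem j) hcap hsep hKA hKB hx hy hxyA.1 hxyA.2 hxy h3 h5
  · push Not at hcase
    exact exists_coloring_of_separation hB hA (fun v hv => (hcup v hv).symm) Set.sdiff_subset hAS
      hiB hjB hiA hjA (h.mem i) (h.mem j) (fun v hv hvA => hcap v hvA hv)
      (fun u hu huA v hv hvB huv => hsep v hv hvB u hu huA huv.symm) hKB hKA hx hy
      ⟨hXS hx, hcase.1⟩ ⟨hXS hy, hcase.2⟩ hxy h3 h5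

/-- A vertex `z` of `X` with few neighbours in `X` is deleted, with two colours reserved for it. -/
theorem exists_coloring_of_isSparseAt {x y z : V} {L : V → Finset C} {φ : V → C}
    (ih : EdgeExtendable V C (S \ {z})) (hXS : X ⊆ S) (hz : z ∈ X) (hzx : z ≠ x) (hzy : z ≠ y)
    (hs : G.IsSparseAt X x y z) (hK : ¬ (G.apex S X).HasK5)
    (hx : x ∈ X) (hy : y ∈ X) (hxy : x = y ∨ G.Adj x y ∧ φ x ≠ φ y)
    (h3 : ∀ v ∈ X, v ≠ x → v ≠ y → 3 ≤ (L v).card) (h5 : ∀ v ∈ S, v ∉ X → 5 ≤ (L v).card) :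
    ∃ c : V → C, (∀ u ∈ S, ∀ v ∈ S, G.Adj u v → c u ≠ c v) ∧ c x = φ x ∧ c y = φ y ∧
      ∀ v ∈ S, v ≠ x → v ≠ y → c v ∈ L v := by
  classical
  obtain ⟨a, w, ha, hnb⟩ := hs
  -- Both reserved colours avoid the colour of `a`, and neighbours of `z` outside `X` will give them
  -- up, going from five colours to three. Only `w` can then block one of the two.
  obtain ⟨α, hα, β, hβ, hαβ⟩ : ∃ α ∈ (L z).erase (φ a), ∃ β ∈ (L z).erase (φ a), α ≠ β := by
    refine Finset.one_lt_card.1 ?_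
    have := Finset.pred_card_le_card_erase (s := L z) (a := φ a)
    have := h3 z hz hzx hzy
    omega
  rw [Finset.mem_erase] at hα hβ
  let L' : V → Finset C := fun v => if G.Adj z v ∧ v ∉ X then ((L v).erase α).erase β else L v
  have hL' : ∀ v, L' v ⊆ L v := by
    intro v
    by_cases h : G.Adj z v ∧ v ∉ X
    · simp only [L', if_pos h]
      exact (Finset.erase_subset _ _).trans (Finset.erase_subset _ _)
    · simp [L', if_neg h]
  obtain ⟨c, hc, hcx, hcy, hcL⟩ := ih G (X \ {z} ∪ {v ∈ S | G.Adj z v}) x y L' φ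
    (by
      rintro v (hv | hv)
      · exact ⟨hXS hv.1, hv.2⟩
      · exact ⟨hv.1, hv.2.ne'⟩)
    (Or.inl ⟨hx, hzx.symm⟩) (Or.inl ⟨hy, hzy.symm⟩) hxy
    (fun h => hK (h.of_isWeakMinor (isWeakMinor_apex_delete hXS hz)))
    (by
      intro v hv hvx hvy
      by_cases hvX : v ∈ X
      · simpa [L', hvX] using h3 v hvX hvx hvy
      · obtain hv | hv := hv
        · exact (hvX hv.1).elim
        · simp only [L', if_pos (And.intro hv.2 hvX)]
          have := h5 v hv.1 hvX
          have := Finset.pred_card_le_card_erase (s := L v) (a := α)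
          have := Finset.pred_card_le_card_erase (s := (L v).erase α) (a := β)
          omega)
    (by
      intro v hv hvX
      have h1 : v ∉ X := fun h => hvX (Or.inl ⟨h, hv.2⟩)
      have h2 : ¬ G.Adj z v := fun h => hvX (Or.inr ⟨hv.1, h⟩)
      simpa [L', h2] using h5 v hv.1 h1)
  obtain ⟨γ, hγ, hγw⟩ : ∃ γ, (γ = α ∨ γ = β) ∧ c w ≠ γ := by
    by_cases h : c w = α
    · exact ⟨β, Or.inr rfl, h ▸ hαβ⟩
    · exact ⟨α, Or.inl rfl, h⟩
  have hca : c a = φ a := by rcases ha with rfl | rfl <;> assumption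
  have hγz : ∀ v ∈ S, G.Adj z v → c v ≠ γ := by
    intro v hv hzv hcv
    by_cases hvX : v ∈ X
    · rcases hnb v hvX hzv with rfl | rfl
      · rcases hγ with rfl | rfl
        · exact hα.1 (hcv.symm.trans hca)
        · exact hβ.1 (hcv.symm.trans hca)
      · exact hγw hcv
    · have := hcL v ⟨hv, hzv.ne'⟩ (fun h => hvX (h ▸ hx)) (fun h => hvX (h ▸ hy))
      simp only [L', if_pos (And.intro hzv hvX), Finset.mem_erase] at this
      rcases hγ with rfl | rfl
      · exact this.2.1 hcv
      · exact this.1 hcv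
  refine ⟨Function.update c z γ, fun u hu v hv huv => ?_, ?_, ?_, fun v hv hvx hvy => ?_⟩
  · by_cases huz : u = z
    · subst huz
      simpa [huv.ne'] using (hγz v hv huv).symm
    · by_cases hvz : v = z
      · subst hvz
        simpa [huv.ne] using hγz u hu huv.symm
      · simpa [huz, hvz] using hc u ⟨hu, huz⟩ v ⟨hv, hvz⟩ huv
  · simpa [hzx.symm] using hcx
  · simpa [hzy.symm] using hcy
  · by_cases hvz : v = z
    · subst hvz
      rcases hγ with rfl | rfl
      · simpa using hα.2
      · simpa using hβ.2
    · simpa [hvz] using hL' v (hcL v ⟨hv, hvz⟩ hvx hvy)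

/-- Colour `z` differently from `x` and `y`, then let `z` play the apex. Its neighbours form the new
`X`, which contains `x` and `y`; the others in it keep at least four colours, more than enough. -/
theorem exists_coloring_of_common_adj {x y z : V} {L : V → Finset C} {φ : V → C}
    (ih : EdgeExtendable V C (S \ {z})) (hz : z ∈ S) (hxz : G.Adj x z) (hyz : G.Adj y z)
    (hK : ¬ (G.apex S X).HasK5) (hx : x ∈ S) (hy : y ∈ S)
    (hxy : x = y ∨ G.Adj x y ∧ φ x ≠ φ y) (h5 : ∀ v ∈ S, v ≠ x → v ≠ y → 5 ≤ (L v).card) :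
    ∃ c : V → C, (∀ u ∈ S, ∀ v ∈ S, G.Adj u v → c u ≠ c v) ∧ c x = φ x ∧ c y = φ y ∧
      ∀ v ∈ S, v ≠ x → v ≠ y → c v ∈ L v := by
  classical
  obtain ⟨γ, hγ⟩ : (((L z).erase (φ x)).erase (φ y)).Nonempty := by
    refine Finset.card_pos.1 ?_
    have := h5 z hz hxz.ne' hyz.ne'
    have := Finset.pred_card_le_card_erase (s := L z) (a := φ x)
    have := Finset.pred_card_le_card_erase (s := (L z).erase (φ x)) (a := φ y)
    omega
  rw [Finset.mem_erase, Finset.mem_erase] at hγ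
  obtain ⟨c, hc, hcx, hcy, hcL⟩ := ih G {v ∈ S | G.Adj z v} x y
    (fun v => if G.Adj z v then (L v).erase γ else L v) φ (fun v hv => ⟨hv.1, hv.2.ne'⟩)
    ⟨hx, hxz.symm⟩ ⟨hy, hyz.symm⟩ hxy
    (fun h => hK (h.of_isWeakMinor (isWeakMinor_apex_star hz)))
    (by
      intro v hv hvx hvy
      have := h5 v hv.1 hvx hvy
      have := Finset.pred_card_le_card_erase (s := L v) (a := γ)
      simp only [if_pos hv.2]
      omega)
    (by
      intro v hv hvX
      have hzv : ¬ G.Adj z v := fun h => hvX ⟨hv.1, h⟩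
      simp only [if_neg hzv]
      refine h5 v hv.1 ?_ ?_
      · rintro rfl
        exact hzv hxz.symm
      · rintro rfl
        exact hzv hyz.symm)
  have hγz : ∀ v ∈ S, G.Adj z v → c v ≠ γ := by
    intro v hv hzv hcv
    by_cases hvx : v = x
    · subst hvx
      exact hγ.2.1 (hcv.symm.trans hcx)
    by_cases hvy : v = y
    · subst hvy
      exact hγ.1 (hcv.symm.trans hcy)
    have := hcL v ⟨hv, hzv.ne'⟩ hvx hvy
    simp only [if_pos hzv, Finset.mem_erase] at this
    exact this.1 hcv
  refine ⟨Function.update c z γ, fun u hu v hv huv => ?_, ?_, ?_, fun v hv hvx hvy => ?_⟩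
  · by_cases huz : u = z
    · subst huz
      simpa [huv.ne'] using (hγz v hv huv).symm
    · by_cases hvz : v = z
      · subst hvz
        simpa [huv.ne] using hγz u hu huv.symm
      · simpa [huz, hvz] using hc u ⟨hu, huz⟩ v ⟨hv, hvz⟩ huv
  · simpa [hxz.ne] using hcx
  · simpa [hyz.ne] using hcy
  · by_cases hvz : v = z
    · subst hvz
      simpa using hγ.2.2
    · have := hcL v ⟨hv, hvz⟩ hvx hvy
      split_ifs at this
      · simpa [hvz] using Finset.mem_of_mem_erase this
      · simpa [hvz] using this

/-- The set `{x, y}` is connected and is contracted to a new apex. No vertex sees both `x` and `y`,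
so the neighbours lose one colour each and keep four. -/
theorem exists_coloring_of_no_common_adj {x y : V} {L : V → Finset C} {φ : V → C}
    (ih : FourFiveColorable V C (S \ {x, y}))
    (hz : ∀ z ∈ S, G.Adj x z → ¬ G.Adj y z)
    (hK : ¬ (G.apex S X).HasK5) (hx : x ∈ S) (hy : y ∈ S)
    (hxy : x = y ∨ G.Adj x y ∧ φ x ≠ φ y) (h5 : ∀ v ∈ S, v ≠ x → v ≠ y → 5 ≤ (L v).card) :
    ∃ c : V → C, (∀ u ∈ S, ∀ v ∈ S, G.Adj u v → c u ≠ c v) ∧ c x = φ x ∧ c y = φ y ∧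
      ∀ v ∈ S, v ≠ x → v ≠ y → c v ∈ L v := by
  classical
  let L' : V → Finset C := fun v =>
    if G.Adj x v then (L v).erase (φ x) else if G.Adj y v then (L v).erase (φ y) else L v
  obtain ⟨c, hc, hcL⟩ := ih G {v ∈ S \ {x, y} | G.Adj x v ∨ G.Adj y v} L' (fun v hv => hv.1)
    (by
      refine fun h => hK (h.of_isWeakMinor (isWeakMinor_apex_contract (fun v hv => hv.1)
        Set.sdiff_subset (some '' {x, y}) (PreconnOn.image_some ?_ ?_) ?_ ?_))
      · rcases hxy with rfl | hxy
        · exact preconnOn_of_subsingleton (by simp)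
        · exact (preconnOn_of_subsingleton Set.subsingleton_singleton).union
            (preconnOn_of_subsingleton Set.subsingleton_singleton) rfl rfl hxy.1
      · rintro v (rfl | rfl) <;> assumption
      · rintro v hv ⟨w, hw, hwv⟩
        exact hv.2 (Option.some.inj hwv ▸ hw)
      · rintro v ⟨hv, hvx | hvy⟩
        · exact ⟨some x, ⟨x, Or.inl rfl, rfl⟩, hx, hv.1, hvx⟩
        · exact ⟨some y, ⟨y, Or.inr rfl, rfl⟩, hy, hv.1, hvy⟩)
    (by
      rintro v ⟨⟨hvS, hv⟩, -⟩
      have := h5 v hvS (fun h => hv (Or.inl h)) (fun h => hv (Or.inr h))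
      have := Finset.pred_card_le_card_erase (s := L v) (a := φ x)
      have := Finset.pred_card_le_card_erase (s := L v) (a := φ y)
      simp only [L']
      split_ifs <;> omega)
    (by
      rintro v ⟨hvS, hv⟩ hvX
      have h1 : ¬ G.Adj x v := fun h => hvX ⟨⟨hvS, hv⟩, Or.inl h⟩
      have h2 : ¬ G.Adj y v := fun h => hvX ⟨⟨hvS, hv⟩, Or.inr h⟩
      simpa [L', h1, h2] using h5 v hvS (fun h => hv (Or.inl h)) (fun h => hv (Or.inr h)))
  have hcx : ∀ v ∈ S, v ≠ x → v ≠ y → G.Adj x v → c v ≠ φ x := by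
    intro v hv hvx hvy hxv
    have := hcL v ⟨hv, by simp [hvx, hvy]⟩
    simp only [L', if_pos hxv, Finset.mem_erase] at this
    exact this.1
  have hcy : ∀ v ∈ S, v ≠ x → v ≠ y → G.Adj y v → c v ≠ φ y := by
    intro v hv hvx hvy hyv
    have := hcL v ⟨hv, by simp [hvx, hvy]⟩
    have hxv : ¬ G.Adj x v := fun h => hz v hv h hyv
    simp only [L', if_neg hxv, if_pos hyv, Finset.mem_erase] at this
    exact this.1
  have key : ∀ u ∈ S, u = x ∨ u = y → ∀ v ∈ S, v ≠ x → v ≠ y → G.Adj u v → φ u ≠ c v := by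
    rintro u - (rfl | rfl) v hv hvx hvy huv
    · exact (hcx v hv hvx hvy huv).symm
    · exact (hcy v hv hvx hvy huv).symm
  have key2 : ∀ u v, (u = x ∨ u = y) → (v = x ∨ v = y) → G.Adj u v → φ u ≠ φ v := by
    rintro u v (rfl | rfl) (rfl | rfl) huv
    · exact (huv.ne rfl).elim
    · exact (hxy.resolve_left huv.ne).2
    · exact (hxy.resolve_left huv.ne').2.symm
    · exact (huv.ne rfl).elim
  refine ⟨fun v => if v = x ∨ v = y then φ v else c v, fun u hu v hv huv => ?_, by simp, by simp,
    fun v hv hvx hvy => ?_⟩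
  · by_cases h1 : u = x ∨ u = y <;> by_cases h2 : v = x ∨ v = y
    · simpa only [if_pos h1, if_pos h2] using key2 u v h1 h2 huv
    · simp only [if_pos h1, if_neg h2]
      push Not at h2
      exact key u hu h1 v hv h2.1 h2.2 huv
    · simp only [if_neg h1, if_pos h2]
      push Not at h1
      exact (key v hv h2 u hu h1.1 h1.2 huv.symm).symm
    · simp only [if_neg h1, if_neg h2]
      push Not at h1 h2
      exact hc u ⟨hu, by simp [h1]⟩ v ⟨hv, by simp [h2]⟩ huv
  · have := hcL v ⟨hv, by simp [hvx, hvy]⟩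
    simp only [L'] at this
    simp only [hvx, hvy, or_self, if_false]
    split_ifs at this
    · exact Finset.mem_of_mem_erase this
    · exact Finset.mem_of_mem_erase this
    · exact this

/-! ### The simultaneous induction. -/

theorem edgeExtendable_of_ssubset [Finite V] (hE : ∀ S', S' ⊂ S → EdgeExtendable V C S')
    (hF : ∀ S', S' ⊂ S → FourFiveColorable V C S') : EdgeExtendable V C S := by
  intro G X x y L φ hXS hx hy hxy hK h3 h5
  have hss : ∀ z ∈ S, S \ {z} ⊂ S := fun z hz => ⟨Set.sdiff_subset, fun h => (h hz).2 rfl⟩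
  by_cases hne : ∃ z ∈ X, z ≠ x ∧ z ≠ y
  · have hgood : (∃ z ∈ X, z ≠ x ∧ z ≠ y ∧ G.IsSparseAt X x y z) → ∃ c : V → C,
        (∀ u ∈ S, ∀ v ∈ S, G.Adj u v → c u ≠ c v) ∧ c x = φ x ∧ c y = φ y ∧
        ∀ v ∈ S, v ≠ x → v ≠ y → c v ∈ L v := by
      rintro ⟨z, hz, hzx, hzy, hs⟩
      exact exists_coloring_of_isSparseAt (hE _ (hss z (hXS hz))) hXS hz hzx hzy hs hK hx hy hxy
        h3 h5
    rcases exists_isSparseAt_or_isPeriodicCycle hx hy (hxy.imp_right And.left) hne with h | h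
    · exact hgood h
    · classical
      -- A shortest cycle in `X`.
      obtain ⟨p, hp⟩ := Nat.find_spec h
      by_cases hXp : X ⊆ Set.range p
      · exact hgood (hp.exists_isSparseAt (fun m q hq => Nat.find_min' h ⟨q, hq⟩) hXp hx
          (hxy.imp_right And.left))
      · obtain ⟨t, htX, ht⟩ := Set.not_subset.1 hXp
        exact exists_coloring_of_isPeriodicCycle hE hp hXS htX (fun i hi => ht ⟨i, hi⟩) hK hx hy hxy
          h3 h5
  · push Not at hne
    have h5' : ∀ v ∈ S, v ≠ x → v ≠ y → 5 ≤ (L v).card := fun v hv hvx hvy =>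
      h5 v hv fun hvX => hvy (hne v hvX hvx)
    by_cases hz : ∃ z ∈ S, G.Adj x z ∧ G.Adj y z
    · obtain ⟨z, hz, hxz, hyz⟩ := hz
      exact exists_coloring_of_common_adj (hE _ (hss z hz)) hz hxz hyz hK (hXS hx) (hXS hy) hxy h5'
    · push Not at hz
      exact exists_coloring_of_no_common_adj
        (hF _ ⟨Set.sdiff_subset, fun h => (h (hXS hx)).2 (Or.inl rfl)⟩) hz hK (hXS hx) (hXS hy) hxy
        h5'

/-- If `X` spans an edge, precolour it from its lists. Otherwise colour and delete some `z ∈ X`: its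
neighbours lie outside `X`, so they drop from five colours to four. If `X` is empty, any `z` will do
and becomes the apex. -/
theorem fourFiveColorable_of_ssubset [Nonempty C] (hE : EdgeExtendable V C S)
    (hF : ∀ S', S' ⊂ S → FourFiveColorable V C S') : FourFiveColorable V C S := by
  classical
  intro G X L hXS hK h4 h5
  by_cases hedge : ∃ x ∈ X, ∃ y ∈ X, G.Adj x y
  · obtain ⟨x, hx, y, hy, hxy⟩ := hedge
    obtain ⟨α, hα⟩ : (L x).Nonempty := Finset.card_pos.1 (by have := h4 x hx; omega)
    obtain ⟨β, hβ⟩ : ((L y).erase α).Nonempty := by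
      refine Finset.card_pos.1 ?_
      have := h4 y hy
      have := Finset.pred_card_le_card_erase (s := L y) (a := α)
      omega
    rw [Finset.mem_erase] at hβ
    obtain ⟨c, hc, hcx, hcy, hcL⟩ := hE G X x y L (fun v => if v = x then α else β) hXS hx hy
      (Or.inr ⟨hxy, by simpa [hxy.ne'] using hβ.1.symm⟩) hK
      (fun v hv _ _ => (h4 v hv).trans' (by omega)) h5
    refine ⟨c, hc, fun v hv => ?_⟩
    by_cases hvx : v = x
    · subst hvx
      rw [hcx]
      simpa using hα
    by_cases hvy : v = y
    · subst hvy
      rw [hcy]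
      simpa [hvx] using hβ.2
    exact hcL v hv hvx hvy
  push Not at hedge
  by_cases hS : S = ∅
  · subst hS
    exact ⟨fun _ => Classical.arbitrary C, by simp, by simp⟩
  obtain ⟨z, hz, hzX⟩ : ∃ z ∈ S, z ∈ X ∨ X = ∅ := by
    rcases X.eq_empty_or_nonempty with h | ⟨z, hz⟩
    · obtain ⟨z, hz⟩ := Set.nonempty_iff_ne_empty.2 hS
      exact ⟨z, hz, Or.inr h⟩
    · exact ⟨z, hXS hz, Or.inl hz⟩
  have h4S : ∀ v ∈ S, 4 ≤ (L v).card := by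
    intro v hv
    by_cases hvX : v ∈ X
    · exact h4 v hvX
    · exact (h5 v hv hvX).trans' (by omega)
  obtain ⟨γ, hγ⟩ : (L z).Nonempty := Finset.card_pos.1 (by have := h4S z hz; omega)
  obtain ⟨c, hc, hcL⟩ := hF (S \ {z}) ⟨Set.sdiff_subset, fun h => (h hz).2 rfl⟩ G
    (X \ {z} ∪ {v ∈ S | G.Adj z v}) (fun v => if G.Adj z v then (L v).erase γ else L v)
    (by
      rintro v (hv | hv)
      · exact ⟨hXS hv.1, hv.2⟩
      · exact ⟨hv.1, hv.2.ne'⟩)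
    (by
      rcases hzX with hzX | rfl
      · exact fun h => hK (h.of_isWeakMinor (isWeakMinor_apex_delete hXS hzX))
      · rw [Set.empty_sdiff, Set.empty_union]
        exact fun h => hK (h.of_isWeakMinor (isWeakMinor_apex_star hz)))
    (by
      intro v hv
      have hvS : v ∈ S := hv.elim (fun h => hXS h.1) fun h => h.1
      by_cases hzv : G.Adj z v
      · have hvX : v ∉ X := by
          rcases hzX with hzX | rfl
          · exact fun h => hedge z hzX v h hzv
          · exact Set.notMem_empty v
        have := h5 v hvS hvX
        have := Finset.pred_card_le_card_erase (s := L v) (a := γ)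
        simp only [if_pos hzv]
        omega
      · simpa only [if_neg hzv] using h4S v hvS)
    (by
      intro v hv hvX
      have hzv : ¬ G.Adj z v := fun h => hvX (Or.inr ⟨hv.1, h⟩)
      simpa only [if_neg hzv] using h5 v hv.1 fun h => hvX (Or.inl ⟨h, hv.2⟩))
  have hγz : ∀ v ∈ S, G.Adj z v → c v ≠ γ := by
    intro v hv hzv
    have := hcL v ⟨hv, hzv.ne'⟩
    simp only [if_pos hzv, Finset.mem_erase] at this
    exact this.1
  refine ⟨Function.update c z γ, fun u hu v hv huv => ?_, fun v hv => ?_⟩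
  · by_cases huz : u = z
    · subst huz
      simpa [huv.ne'] using (hγz v hv huv).symm
    · by_cases hvz : v = z
      · subst hvz
        simpa [huv.ne] using hγz u hu huv.symm
      · simpa [huz, hvz] using hc u ⟨hu, huz⟩ v ⟨hv, hvz⟩ huv
  · by_cases hvz : v = z
    · subst hvz
      simpa using hγ
    · have := hcL v ⟨hv, hvz⟩
      split_ifs at this
      · simpa [hvz] using Finset.mem_of_mem_erase this
      · simpa [hvz] using this

/-- The order matters: `FourFiveColorable` at `S` uses `EdgeExtendable` at the same `S`, which
itself depends only on proper subsets. -/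
theorem edgeExtendable_and_fourFiveColorable [Finite V] [Nonempty C] (S : Set V) :
    EdgeExtendable V C S ∧ FourFiveColorable V C S := by
  induction S using WellFoundedLT.induction with
  | ind S ih =>
    have hE := edgeExtendable_of_ssubset (fun S' h => (ih S' h).1) fun S' h => (ih S' h).2
    exact ⟨hE, fourFiveColorable_of_ssubset hE fun S' h => (ih S' h).2⟩

end Coloring

end SimpleGraph

theorem mainTheorem1 {V : Type u} [Finite V] (G : SimpleGraph V)
    (hG : ¬ SimpleGraph.IsMinor (SimpleGraph.completeGraph (Fin 5)) G) :
    SimpleGraph.IsChoosable.{u, w} G 5 := by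
  intro C L hL
  -- Lists may be infinite, so they are first cut down to five colours.
  have hfin : ∀ v, ∃ s : Finset C, (s : Set C) ⊆ L v ∧ s.card = 5 := by
    intro v
    obtain ⟨t, ht, htc⟩ := Set.exists_subset_encard_eq (hL v)
    have htf : t.Finite := Set.finite_of_encard_eq_coe htc
    refine ⟨htf.toFinset, by simpa using ht, ?_⟩
    rw [htf.encard_eq_coe_toFinset_card] at htc
    exact_mod_cast htc
  choose s hs hs5 using hfin
  rcases isEmpty_or_nonempty V with hV | ⟨⟨v⟩⟩
  · exact ⟨SimpleGraph.Coloring.mk (fun v => hV.elim v) fun {v} => hV.elim v, fun v => hV.elim v⟩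
  · obtain ⟨γ, -⟩ : (s v).Nonempty := Finset.card_pos.1 (by rw [hs5]; omega)
    have : Nonempty C := ⟨γ⟩
    -- With `X = ∅` the apex is isolated and every list has to have five colours.
    obtain ⟨c, hc, hcL⟩ := (SimpleGraph.edgeExtendable_and_fourFiveColorable (C := C)
      (Set.univ : Set V)).2 G ∅ s (Set.empty_subset _) (SimpleGraph.not_hasK5_apex_univ_empty hG)
      (fun v hv => hv.elim) (fun v _ _ => (hs5 v).ge)
    exact ⟨SimpleGraph.Coloring.mk c fun {u v} huv => hc u trivial v trivial huv,
      fun v => hs v (hcL v trivial)⟩
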